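/- Let $p$ be a prime, $q$ a power of $p$, $k,t$ positive integers, $r$ a non-negative integer, $q'=p^r$, $p_i=1+q'+\cdots+q'^i$ for $i\ge 0$ and $p_{-1}=0$. Let $n=tp_k$, let $m$ be a positive multiple of $n$, let $s$ be a positive integer coprime with $n$, and let $\sigma\colon x\mapsto x^{q^s}$ on $\mathbb F_{q^m}$. The rank weight $\mathrm{rk}(v)$ of $v\in\mathbb F_{q^m}^n$ is the dimension of the $\mathbb F_q$-span of its entries, $d(u,v)=\mathrm{rk}(u-v)$, and $B_\tau(w)=\{c\in\mathbb F_{q^m}^n:\mathrm{rk}(w-c)\le\tau\}$. Let $\mathcal C$ be a set of $\sigma$-polynomials $\sum_i a_ix^{\sigma^i}$, $a_i\in\mathbb F_{q^m}$ (identified with the $\mathbb F_q$-linear maps of $\mathbb F_{q^m}$ that they induce), let $\beta\in\mathbb F_{q^m}^*$, let $b_1,\dots,b_n$ be an $\mathbb F_q$-basis of $\beta\,\mathbb F_{q^n}$, and let $\mathrm C=\{(f(b_1),\dots,f(b_n)):f\in\mathcal C\}\subseteq\mathbb F_{q^m}^n$, with minimum distance $d$. For a positive integer $h$ let $\mathcal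 G_{h,\sigma}(E)=\{\sum_{i=0}^{h-1}a_ix^{\sigma^i}:a_i\in E\}$, and write $\mathcal A^{\sigma^j}=\{f(x)^{\sigma^j}:f\in\mathcal A\}$. Suppose that 1. $\lfloor\frac{d-1}{2}\rfloor+1\le tq'^k\le d-1$; 2. for some $0\le j<tq'^k$, either $\mathcal G_{tp_{k-2}+1,\sigma}(\mathbb F_{q^m})^{\sigma^j}\subseteq\mathcal C$, or $\beta\in\mathbb F_{q^n}$ and $\mathcal G_{tp_{k-2}+1,\sigma}(\mathbb F_{q^n})^{\sigma^j}\subseteq\mathcal C$. Then $\mathrm C$ cannot be list decoded efficiently at any radius $\tau\ge tq'^k$. Precisely: (a) For every integer $\tau\ge tq'^k$ there is a word $w\in\mathbb F_{q^m}^n\setminus\mathrm C$ with $$|\mathrm C\cap B_\tau(w)|\ \ge\ \frac{q^n-1}{q^t-1}.$$ (b) Take any family of such codes $\mathrm C_\iota$ (all parameters may vary with $\iota$) whose lengths $n_\iota$ are unbounded, and radii $\tau_\iota\ge t_\iota q_\iota'^{k_\iota}$. There is no polynomial $P$ such that every $\mathrm C_\iota$ has a list decoding algorithm at radius $\tau_\iota$,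 that is, one which on every word $w$ of the ambient space writes down the list of exactly the codewords in $B_{\tau_\iota}(w)$, with running time at most $P(n_\iota)$. Here an algorithm is a deterministic single-tape Turing machine with finitely many states and a finite tape alphabet containing the alphabet $\mathbb F_{q_\iota^{m_\iota}}$ of the code as non-blank symbols; it may depend on the code in any way, words are written one field element per cell, and the running time is the number of steps. -/

import Mathlib

namespace RankMetric

universe u v

/-- `geomSum q' a = 1 + q' + ⋯ + q' ^ (a - 1)` (`a` summands), so that
`p_i = 1 + q' + ⋯ + q' ^ i` is `geomSum q' (i + 1)`; the empty sum `p_{-1}` is `0`. -/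
def geomSum (q' a : ℕ) : ℕ := ∑ i ∈ Finset.range a, q' ^ i

section Linearized

variable {F : Type u} {K : Type v} [Field F] [Field K] [Algebra F K]

/-- The `F`-linear map `x ↦ ∑_{i < d} a i * σ^i (x)` of the `σ`-polynomial with coefficients `a`. -/
noncomputable def sigmaPoly (σ : K ≃ₐ[F] K) {d : ℕ} (a : Fin d → K) : K →ₗ[F] K :=
  ∑ i : Fin d, LinearMap.mulLeft F (a i) ∘ₗ (σ ^ (i : ℕ)).toLinearMap

theorem sigmaPoly_apply (σ : K ≃ₐ[F] K) {d : ℕ} (a : Fin d → K) (x : K) :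
    sigmaPoly σ a x = ∑ i : Fin d, a i * (σ ^ (i : ℕ)) x := by
  simp [sigmaPoly, LinearMap.sum_apply]

/-- The `σ`-polynomials with coefficients in `K`, identified with the maps that they induce. -/
def sigmaPolys (σ : K ≃ₐ[F] K) : Set (K →ₗ[F] K) :=
  {f | ∃ (d : ℕ) (a : Fin d → K), f = sigmaPoly σ a}

/-- The generalized Gabidulin code of all `σ`-polynomials `∑_{i < h} a_i x^{σ^i}` with coefficients
in the intermediate field `E` (`E = ⊤`: all coefficients in `K`). -/
def gabidulin (σ : K ≃ₐ[F] K) (E : IntermediateField F K) (h : ℕ) : Set (K →ₗ[F] K) :=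
  {f | ∃ a : Fin h → K, (∀ i, a i ∈ E) ∧ f = sigmaPoly σ a}

/-- `𝒞^{σ^j} = {f(x)^{σ^j} : f ∈ 𝒞}`. -/
def sigmaTwist (σ : K ≃ₐ[F] K) (j : ℕ) (𝒞 : Set (K →ₗ[F] K)) : Set (K →ₗ[F] K) :=
  (fun f => (σ ^ j).toLinearMap ∘ₗ f) '' 𝒞

/-- The evaluation code `{(f (b 1), …, f (b n)) : f ∈ 𝒞}`. -/
def evalCode {n : ℕ} (b : Fin n → K) (𝒞 : Set (K →ₗ[F] K)) : Set (Fin n → K) :=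
  (fun f i => f (b i)) '' 𝒞

/-- `b` is an `F`-basis of the `F`-subspace `β E` of `K`. -/
def IsBasisOfScaled {n : ℕ} (b : Fin n → K) (β : K) (E : IntermediateField F K) : Prop :=
  LinearIndependent F b ∧
    (Submodule.span F (Set.range b) : Set K) = {x | ∃ y ∈ E, x = β * y}

end Linearized

section Rank

variable (F : Type u) {K : Type v} [Field F] [Field K] [Algebra F K] {n : ℕ}

/-- The rank weight of a vector: the dimension of the `F`-span of its entries. -/
noncomputable def rk (v : Fin n → K) : ℕ :=
  Module.finrank F (Submodule.span F (Set.range v))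

/-- The ball of radius `τ` around `w` in the rank metric. -/
def rankBall (τ : ℕ) (w : Fin n → K) : Set (Fin n → K) := {c | rk F (w - c) ≤ τ}

/-- The minimum distance of a code in the rank metric (`0` for a code with at most one word). -/
noncomputable def minDist (C : Set (Fin n → K)) : ℕ :=
  sInf {d | ∃ u ∈ C, ∃ v ∈ C, u ≠ v ∧ d = rk F (u - v)}

end Rank

section Decoding

open Turing

/-- A (single tape, deterministic) Turing machine whose tape can carry symbols from `K`: finitely
many states, a finite tape alphabet, and an embedding of `K` into the non-blank tape symbols. -/
structure TapeMachine (K : Type v) where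
  Sym : Type
  State : Type
  [symInhabited : Inhabited Sym]
  [symFinite : Finite Sym]
  [stateInhabited : Inhabited State]
  [stateFinite : Finite State]
  enc : K ↪ Sym
  enc_ne_blank : ∀ x, enc x ≠ default
  machine : TM0.Machine Sym State

attribute [instance] TapeMachine.symInhabited TapeMachine.symFinite
  TapeMachine.stateInhabited TapeMachine.stateFinite

/-- The machine, started on the word `inp`, halts after at most `T` steps, and then the tape reads
`out` from the head to the right, followed by blanks only. -/
def TapeMachine.OutputsInTime {K : Type v} (A : TapeMachine K) (inp out : List K) (T : ℕ) : Prop :=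
  ∃ c : TM0.Cfg A.Sym A.State,
    Nonempty (StateTransition.EvalsToInTime (TM0.step A.machine)
      (TM0.init (inp.map A.enc)) (some c) T) ∧
    TM0.step A.machine c = none ∧
    c.Tape.right₀ = ListBlank.mk (out.map A.enc)

/-- `A` is a list decoding algorithm for `C` at radius `τ` with running time at most `T`: on every
word `w` it writes down, one after the other, exactly the codewords at distance at most `τ`
from `w`. -/
def TapeMachine.ListDecodesInTime (F : Type u) {K : Type v} [Field F] [Field K] [Algebra F K]
    {n : ℕ} (A : TapeMachine K) (C : Set (Fin n → K)) (τ T : ℕ) : Prop :=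
  ∀ w : Fin n → K, ∃ l : List (Fin n → K),
    (∀ c, c ∈ l ↔ c ∈ C ∩ rankBall F τ w) ∧
    A.OutputsInTime (List.ofFn w) (l.flatMap List.ofFn) T

/-- A family of codes `C i ⊆ (K i)^(n i)` is efficiently list decodable at the radii `τ i` if the
codes have list decoding algorithms whose running time is bounded by one polynomial in the
length. The algorithm may depend on the code in any way, and one step may process a whole
element of `K i`. -/
def EfficientlyListDecodable {ι : Type*} (F : ι → Type u) {K : ι → Type v}
    [∀ i, Field (F i)] [∀ i, Field (K i)] [∀ i, Algebra (F i) (K i)]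
    {n : ι → ℕ} (C : ∀ i, Set (Fin (n i) → K i)) (τ : ι → ℕ) : Prop :=
  ∃ P : Polynomial ℕ, ∀ i, ∃ A : TapeMachine (K i),
    A.ListDecodesInTime (F i) (C i) (τ i) (P.eval (n i))

end Decoding

end RankMetric

namespace RankMetric

open Polynomial

/-! Let `S = ∑_{i ≤ k} X^(t p_{i-1})`. Raising to the power `q'` is additive in characteristic `p`,
and `1 + q' p_{i-1} = p_i`, so `X^t S^q' = S - 1 + X^n`. Hence `S` divides `X^n - 1` with a cofactor
of degree `t q'^k` (`exists_cofactor_lacunaryTrace`). If `τ` generates `Gal(L/F)`, where `[L : F] =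
n`, then `S(τ)` has rank at most `t q'^k` (`finrank_range_aeval_le`).

Precomposing with multiplication by `α` and making the result monic keeps this bound. All these maps
share the leading term `τ^(t p_{k-1})`, and their other exponents are at most `t p_{k-2}`. Take for
`w` the word of the leading term, transported by `β` and `σ^j`: subtracting the transported map
leaves a codeword (`sub_mem_evalCode`). Two units give the same map only if their quotient is fixed
by `τ^t`, so at least `(q^n-1)/(q^t-1)` codewords arise. As they lie closer to `w` than the minimum
distance, `w` is not a codeword.

For (b), a machine running `T` steps leaves at most `n + T` written cells ahead of its head, whereas
the list has at least `2^(n/2)` words. -/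

theorem geomSum_succ (q' a : ℕ) : geomSum q' (a + 1) = geomSum q' a + q' ^ a :=
  Finset.sum_range_succ _ _

theorem geomSum_succ' (q' a : ℕ) : geomSum q' (a + 1) = 1 + q' * geomSum q' a := by
  simp only [geomSum, Finset.sum_range_succ', Finset.mul_sum, pow_zero, pow_succ']
  ring

theorem geomSum_strictMono {q' : ℕ} (h : 0 < q') : StrictMono (geomSum q') :=
  strictMono_nat_of_lt_succ fun a => by
    rw [geomSum_succ]; exact Nat.lt_add_of_pos_right (pow_pos h a)

theorem one_lt_geomSum_succ {q' k : ℕ} (h : 0 < q') (hk : 0 < k) : 1 < geomSum q' (k + 1) := by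
  simpa [geomSum] using geomSum_strictMono h (Nat.lt_add_of_pos_left (n := 1) hk)

/-- The polynomial `∑_{i ≤ k} X ^ (t * p_{i - 1})`. -/
noncomputable def lacunaryTrace (F : Type*) [Field F] (q' t k : ℕ) : F[X] :=
  ∑ i ∈ Finset.range (k + 1), X ^ (t * geomSum q' i)

/-! ### The factorization of `X^n - 1`. -/

section Lacunary

variable {F : Type*} [Field F] {q' t k : ℕ}

theorem degree_sum_X_pow_lt (hq' : 0 < q') (ht : 0 < t) :
    (∑ i ∈ Finset.range k, (X : F[X]) ^ (t * geomSum q' i)).degree < (t * geomSum q' k : ℕ) := by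
  refine (degree_sum_le _ _).trans_lt ?_
  rw [Finset.sup_lt_iff (WithBot.bot_lt_coe _)]
  intro i hi
  rw [degree_X_pow, Nat.cast_lt]
  exact Nat.mul_lt_mul_of_pos_left (geomSum_strictMono hq' (Finset.mem_range.1 hi)) ht

theorem lacunaryTrace_eq :
    lacunaryTrace F q' t k =
      X ^ (t * geomSum q' k) + ∑ i ∈ Finset.range k, (X : F[X]) ^ (t * geomSum q' i) := by
  rw [lacunaryTrace, Finset.sum_range_succ, add_comm]

theorem lacunaryTrace_monic (hq' : 0 < q') (ht : 0 < t) : (lacunaryTrace F q' t k).Monic := by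
  rw [lacunaryTrace_eq]
  exact monic_X_pow_add (degree_sum_X_pow_lt hq' ht)

theorem natDegree_lacunaryTrace (hq' : 0 < q') (ht : 0 < t) :
    (lacunaryTrace F q' t k).natDegree = t * geomSum q' k := by
  rw [lacunaryTrace_eq, natDegree_add_eq_left_of_degree_lt, natDegree_X_pow]
  rw [degree_X_pow]
  exact degree_sum_X_pow_lt hq' ht

theorem exists_cofactor_lacunaryTrace (p r : ℕ) [Fact p.Prime] [CharP F p] (ht : 0 < t) :
    ∃ Q : F[X], Q.Monic ∧ Q.natDegree = t * (p ^ r) ^ k ∧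
      lacunaryTrace F (p ^ r) t k * Q = X ^ (t * geomSum (p ^ r) (k + 1)) - 1 := by
  have hp : 0 < p ^ r := pow_pos (Fact.out : p.Prime).pos r
  set S := lacunaryTrace F (p ^ r) t k with hS
  -- The left side shifts every exponent of `S` to the next one: the term `1` is lost and `X^n` is
  -- gained.
  have hfrob : X ^ t * S ^ p ^ r = S - 1 + X ^ (t * geomSum (p ^ r) (k + 1)) := by
    have h1 : X ^ t * S ^ p ^ r =
        ∑ i ∈ Finset.range (k + 1), (X : F[X]) ^ (t * geomSum (p ^ r) (i + 1)) := by
      rw [hS, lacunaryTrace, sum_pow_char_pow, Finset.mul_sum]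
      refine Finset.sum_congr rfl fun i _ => ?_
      rw [← pow_mul, ← pow_add, geomSum_succ']
      congr 1; ring
    have h2 := Finset.sum_range_succ' (fun i => (X : F[X]) ^ (t * geomSum (p ^ r) i)) (k + 1)
    rw [Finset.sum_range_succ] at h2
    rw [h1, hS, lacunaryTrace]
    simp only [geomSum, Finset.range_zero, Finset.sum_empty, mul_zero, pow_zero] at h2 ⊢
    rw [sub_add_eq_add_sub, h2]; ring
  have hmul : S * (X ^ t * S ^ (p ^ r - 1) - 1) =
      X ^ (t * geomSum (p ^ r) (k + 1)) - 1 := by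
    have : S * (X ^ t * S ^ (p ^ r - 1) - 1) = X ^ t * (S ^ (p ^ r - 1) * S) - S := by ring
    rw [this, ← pow_succ, Nat.sub_add_cancel hp, hfrob]; ring
  have hn : t * geomSum (p ^ r) (k + 1) ≠ 0 :=
    (Nat.mul_pos ht (by rw [geomSum_succ']; omega)).ne'
  have hSm : S.Monic := lacunaryTrace_monic hp ht
  have hQ : (X ^ t * S ^ (p ^ r - 1) - 1).Monic :=
    hSm.of_mul_monic_left (hmul ▸ monic_X_pow_sub_C 1 hn)
  refine ⟨_, hQ, ?_, hmul⟩
  have hdeg := hSm.natDegree_mul hQ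
  have h3 : (X ^ (t * geomSum (p ^ r) (k + 1)) - 1 : F[X]).natDegree =
    t * geomSum (p ^ r) (k + 1) := natDegree_X_pow_sub_C (r := (1 : F))
  rw [hmul, h3, natDegree_lacunaryTrace hp ht, geomSum_succ, mul_add] at hdeg
  omega

end Lacunary

/-! ### Low-rank `τ`-polynomials and their coefficients. -/

section Cyclic

variable {F L : Type*} [Field F] [Field L] [Algebra F L]

theorem aeval_lacunaryTrace_apply (τ : L ≃ₐ[F] L) (q' t k : ℕ) (x : L) :
    aeval τ.toLinearMap (lacunaryTrace F q' t k) x =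
      ∑ i ∈ Finset.range (k + 1), (τ ^ (t * geomSum q' i)) x := by
  have h : ∀ (m : ℕ) (x : L), (τ.toLinearMap ^ m) x = (τ ^ m) x := fun m x => by
    rw [Module.End.pow_apply, AlgEquiv.coe_pow]; rfl
  simp [lacunaryTrace, LinearMap.sum_apply, h]

/-- By the normal basis theorem `L` is a cyclic `F[τ]`-module, generated by some `x₀`. The range of
`P(τ)` is therefore generated by `y = P(τ) x₀`, which `Q(τ)` kills, so the vectors `τ^i y` with `i <
deg Q` span it. -/
theorem finrank_range_aeval_le [FiniteDimensional F L] [IsGalois F L] (τ : L ≃ₐ[F] L)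
    (hτ : ∀ g : L ≃ₐ[F] L, ∃ i : ℕ, g = τ ^ i) {n : ℕ} (hn : τ ^ n = 1) {P Q : F[X]}
    (hQ : Q.Monic) (hPQ : P * Q = X ^ n - 1) :
    Module.finrank F (LinearMap.range (aeval τ.toLinearMap P)) ≤ Q.natDegree := by
  set φ : Module.End F L := τ.toLinearMap
  have hpow : ∀ (m : ℕ) (x : L), (φ ^ m) x = (τ ^ m) x := fun m x => by
    rw [Module.End.pow_apply, AlgEquiv.coe_pow]; rfl
  set x₀ := IsGalois.normalBasis F L 1
  set y := aeval φ P x₀ with hy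
  have hQy : aeval φ Q y = 0 := by
    rw [hy, ← Module.End.mul_apply, ← map_mul, mul_comm, hPQ]
    simp [hpow, hn]
  let W := Submodule.span F ((fun i => (φ ^ i) y) '' (Finset.range Q.natDegree : Set ℕ))
  have hW : ∀ R : F[X], aeval φ R y ∈ W := by
    intro R
    have h1 : aeval φ R y = aeval φ (R %ₘ Q) y := by
      conv_lhs => rw [← modByMonic_add_div R Q]
      rw [mul_comm Q, map_add, map_mul, LinearMap.add_apply, Module.End.mul_apply, hQy, map_zero,
        add_zero]
    rw [h1]
    by_cases hQ1 : Q = 1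
    · simp [hQ1]
    rw [aeval_eq_sum_range' (natDegree_modByMonic_lt R hQ hQ1), LinearMap.sum_apply]
    exact Submodule.sum_mem _ fun i hi =>
      Submodule.smul_mem _ _ (Submodule.subset_span ⟨i, by simpa using hi, rfl⟩)
  have hle : LinearMap.range (aeval φ P) ≤ W := by
    rw [LinearMap.range_eq_map, ← (IsGalois.normalBasis F L).span_eq, Submodule.map_span,
      Submodule.span_le]
    rintro _ ⟨_, ⟨g, rfl⟩, rfl⟩
    obtain ⟨i, rfl⟩ := hτ g
    rw [IsGalois.normalBasis_apply, ← hpow, ← Module.End.mul_apply]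
    have : aeval φ P * φ ^ i = φ ^ i * aeval φ P := by
      have h := congrArg (aeval φ) (mul_comm P (X ^ i))
      simpa using h
    rw [this, Module.End.mul_apply]
    simpa using hW (X ^ i)
  refine (Submodule.finrank_mono hle).trans ?_
  classical
  have := finrank_span_finset_le_card (R := F)
    ((Finset.range Q.natDegree).image fun i => (φ ^ i) y)
  rw [Finset.coe_image] at this
  exact this.trans (Finset.card_image_le.trans (Finset.card_range _).le)

/-- The `τ`-polynomial `∑_{i ≤ k} τ ^ (t * p_{i - 1}) (α x)`, made monic. -/
noncomputable def monicTwist (τ : L ≃ₐ[F] L) (q' t k : ℕ) (α : Lˣ) : L →ₗ[F] L :=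
  LinearMap.mulLeft F ((τ ^ (t * geomSum q' k)) (α : L))⁻¹ ∘ₗ
    aeval τ.toLinearMap (lacunaryTrace F q' t k) ∘ₗ LinearMap.mulLeft F (α : L)

theorem monicTwist_apply (τ : L ≃ₐ[F] L) (q' t k : ℕ) (α : Lˣ) (x : L) :
    monicTwist τ q' t k α x = ∑ i ∈ Finset.range (k + 1),
      ((τ ^ (t * geomSum q' k)) (α : L))⁻¹ * (τ ^ (t * geomSum q' i)) (α : L) *
        (τ ^ (t * geomSum q' i)) x := by
  simp only [monicTwist, LinearMap.comp_apply, aeval_lacunaryTrace_apply, LinearMap.mulLeft_apply,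
    map_mul, Finset.mul_sum, mul_assoc]

theorem finrank_range_monicTwist_le [FiniteDimensional F L] (τ : L ≃ₐ[F] L) (q' t k : ℕ) (α : Lˣ) :
    Module.finrank F (LinearMap.range (monicTwist τ q' t k α)) ≤
      Module.finrank F (LinearMap.range (aeval τ.toLinearMap (lacunaryTrace F q' t k))) := by
  rw [monicTwist, LinearMap.range_comp]
  refine (Submodule.finrank_map_le _ _).trans (Submodule.finrank_mono ?_)
  exact LinearMap.range_comp_le_range _ _

/-- Dedekind independence of characters: the exponents are below the order of `τ`, so the powers
that occur are distinct automorphisms. -/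
theorem coeff_eq_of_monicTwist_eq (τ : L ≃ₐ[F] L) {q' t k : ℕ} (hq' : 0 < q') (ht : 0 < t)
    (hτ : t * geomSum q' (k + 1) ≤ orderOf τ) {α α' : Lˣ}
    (h : monicTwist τ q' t k α = monicTwist τ q' t k α') {i : ℕ} (hi : i ≤ k) :
    ((τ ^ (t * geomSum q' k)) (α : L))⁻¹ * (τ ^ (t * geomSum q' i)) (α : L) =
      ((τ ^ (t * geomSum q' k)) (α' : L))⁻¹ * (τ ^ (t * geomSum q' i)) (α' : L) := by
  have hli : LinearIndependent L
      (fun i : Fin (k + 1) => ((τ ^ (t * geomSum q' (i : ℕ)) : L ≃ₐ[F] L) : L → L)) := by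
    refine (linearIndependent_monoidHom L L).comp
      (fun i : Fin (k + 1) => ((τ ^ (t * geomSum q' (i : ℕ)) : L ≃ₐ[F] L) : L →* L)) ?_
    intro i i' hii
    have hg : ∀ i : Fin (k + 1), t * geomSum q' i < orderOf τ := fun i =>
      (Nat.mul_lt_mul_of_pos_left (geomSum_strictMono hq' i.2) ht).trans_le hτ
    have h1 : τ ^ (t * geomSum q' (i : ℕ)) = τ ^ (t * geomSum q' (i' : ℕ)) := by
      ext x; exact DFunLike.congr_fun hii x
    have h2 := pow_injOn_Iio_orderOf (hg i) (hg i') h1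
    exact Fin.ext ((geomSum_strictMono hq').injective (Nat.eq_of_mul_eq_mul_left ht h2))
  rw [Fintype.linearIndependent_iff] at hli
  have := hli (fun i => ((τ ^ (t * geomSum q' k)) (α : L))⁻¹ *
      (τ ^ (t * geomSum q' (i : ℕ))) (α : L) - ((τ ^ (t * geomSum q' k)) (α' : L))⁻¹ *
      (τ ^ (t * geomSum q' (i : ℕ))) (α' : L)) ?_ ⟨i, Nat.lt_succ_of_le hi⟩
  · exact sub_eq_zero.1 this
  · ext x
    have hx := LinearMap.congr_fun h x
    rw [monicTwist_apply, monicTwist_apply, ← sub_eq_zero, ← Finset.sum_sub_distrib,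
      Finset.sum_range] at hx
    simpa [Finset.sum_apply, sub_mul] using hx

/-- The coefficients at the exponents `0` and `t` suffice: in their quotient the normalizing factor
cancels. -/
theorem fixed_of_monicTwist_eq (τ : L ≃ₐ[F] L) {q' t k : ℕ} (hq' : 0 < q') (ht : 0 < t)
    (hk : 0 < k) (hτ : t * geomSum q' (k + 1) ≤ orderOf τ) {α α' : Lˣ}
    (h : monicTwist τ q' t k α = monicTwist τ q' t k α') :
    (τ ^ t) ((α : L) / α') = α / α' := by
  have h0 := coeff_eq_of_monicTwist_eq τ hq' ht hτ h (Nat.zero_le k)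
  have h1 := coeff_eq_of_monicTwist_eq τ hq' ht hτ h hk
  have g0 : geomSum q' 0 = 0 := by simp [geomSum]
  have g1 : geomSum q' 1 = 1 := by simp [geomSum]
  rw [g0, mul_zero, pow_zero, AlgEquiv.one_apply, AlgEquiv.one_apply] at h0
  rw [g1, mul_one] at h1
  have hne : ∀ (m : ℕ) (u : Lˣ), (τ ^ m) (u : L) ≠ 0 := fun m u =>
    (map_ne_zero_iff _ (τ ^ m).injective).2 u.ne_zero
  have a0 := hne (t * geomSum q' k) α
  have b0 := hne (t * geomSum q' k) α'
  have c0 := hne t α'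
  have d0 : (α' : L) ≠ 0 := α'.ne_zero
  have e0 : (α : L) ≠ 0 := α.ne_zero
  rw [map_div₀]
  generalize (τ ^ (t * geomSum q' k)) (α : L) = A at *
  generalize (τ ^ (t * geomSum q' k)) (α' : L) = B at *
  generalize (τ ^ t) (α' : L) = C at *
  generalize (τ ^ t) (α : L) = D at *
  field_simp at h0 h1 ⊢
  have : B * (α' * D - C * α) = 0 := by
    linear_combination (α' : L) * h1 - C * h0
  have := (mul_eq_zero.1 this).resolve_left b0
  linear_combination this

end Cyclic

/-! ### Counting the distinct maps. -/

section Counting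

variable {F L : Type*} [Field F] [Field L] [Algebra F L] [Finite L]

/-- Dividing by one member of a fibre of `T` embeds the fibre into the `(q^t - 1)`-th roots of
unity. -/
theorem card_sub_one_le_mul_card_range {t : ℕ} {τ : L ≃ₐ[F] L} {q : ℕ} (hq : 1 < q) (ht : 0 < t)
    (hfix : ∀ x : L, (τ ^ t) x = x → x ^ q ^ t = x) {X : Type*} (T : Lˣ → X)
    (hT : ∀ α α', T α = T α' → (τ ^ t) ((α : L) / α') = α / α') :
    Nat.card L - 1 ≤ (q ^ t - 1) * (Set.range T).ncard := by
  classical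
  have := Fintype.ofFinite L
  have hqt : 1 < q ^ t := Nat.one_lt_pow ht.ne' hq
  have hmain : (Finset.univ : Finset Lˣ).card ≤
      (q ^ t - 1) * ((Finset.univ : Finset Lˣ).image T).card := by
    refine Finset.card_le_mul_card_image _ _ fun v hv => ?_
    obtain ⟨α', -, rfl⟩ := Finset.mem_image.1 hv
    refine le_trans ?_ ((Multiset.toFinset_card_le _).trans (card_nthRoots (q ^ t - 1) (1 : L)))
    refine Finset.card_le_card_of_injOn (fun α => (α : L) / α') ?_ ?_
    · intro α hα
      have h1 := hfix _ (hT α α' (Finset.mem_filter.1 hα).2)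
      have hne : (α : L) / α' ≠ 0 := div_ne_zero α.ne_zero α'.ne_zero
      simp only [Finset.mem_coe, Multiset.mem_toFinset]
      rw [mem_nthRoots (by omega)]
      apply mul_right_cancel₀ hne
      rw [← pow_succ, Nat.sub_add_cancel hqt.le, h1, one_mul]
    · intro α _ α₁ _ h
      exact Units.ext ((div_left_inj' α'.ne_zero).1 h)
  rw [Finset.card_univ, Fintype.card_units] at hmain
  rwa [Nat.card_eq_fintype_card, ← Set.image_univ, ← Finset.coe_univ, ← Finset.coe_image,
    Set.ncard_coe_finset]

end Counting

end RankMetric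

namespace RankMetric

open Polynomial Turing

/-! ### The generator of the Galois group. -/

section Frobenius

variable {F L : Type*} [Field F] [Field L] [Algebra F L] [Finite L]

/-- Since `s` is invertible modulo `n`, some power of `ψ^s` is the Frobenius `ψ` again. Thus `ψ^s`
generates, and fixed points of its `t`-th power are fixed by `ψ^t`. -/
theorem exists_generator_pow_card [Finite F] {s n : ℕ} (hn : Module.finrank F L = n)
    (hs : s.Coprime n) :
    ∃ τ : L ≃ₐ[F] L, (∀ x, τ x = x ^ (Nat.card F) ^ s) ∧ orderOf τ = n ∧
      (∀ g : L ≃ₐ[F] L, ∃ i : ℕ, g = τ ^ i) ∧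
      ∀ (t : ℕ) (x : L), (τ ^ t) x = x → x ^ (Nat.card F) ^ t = x := by
  have := Fintype.ofFinite F
  have : Module.Finite F L := Module.Finite.of_finite
  set ψ := FiniteField.frobeniusAlgEquivOfAlgebraic F L with hψ
  have hψn : orderOf ψ = n := (FiniteField.orderOf_frobeniusAlgEquivOfAlgebraic F L).trans hn
  have hpos : 0 < n := hn ▸ Module.finrank_pos
  have hpow : ∀ (m : ℕ) (x : L), (ψ ^ m) x = x ^ (Nat.card F) ^ m := fun m x => by
    rw [AlgEquiv.coe_pow, hψ, FiniteField.coe_frobeniusAlgEquivOfAlgebraic_iterate,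
      Nat.card_eq_fintype_card]
  have hcop : (orderOf ψ).Coprime s := hψn ▸ hs.symm
  obtain ⟨u, hu⟩ := exists_pow_eq_self_of_coprime hcop.symm
  refine ⟨ψ ^ s, hpow s, ?_, ?_, ?_⟩
  · rw [hcop.orderOf_pow, hψn]
  · intro g
    obtain ⟨i, hi⟩ := (FiniteField.bijective_frobeniusAlgEquivOfAlgebraic_pow F L).2 g
    refine ⟨u * i, ?_⟩
    rw [pow_mul, hu]; exact hi.symm
  · intro t x hx
    rw [← hpow, ← hu, ← pow_mul, mul_comm, pow_mul, AlgEquiv.coe_pow]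
    exact Function.iterate_fixed hx u

end Frobenius

/-! ### From maps on `L` to words over `K`. -/

section Transport

variable {F K : Type*} [Field F] [Field K] [Algebra F K]

theorem exists_mem_gabidulin_eq_sum (σ : K ≃ₐ[F] K) (E : IntermediateField F K) {q' t k : ℕ}
    (hq' : 0 < q') (c : ℕ → K) (hc : ∀ i, c i ∈ E) :
    ∃ f ∈ gabidulin σ E (t * geomSum q' k + 1), ∀ x,
      f x = ∑ i ∈ Finset.range (k + 1), c i * (σ ^ (t * geomSum q' i)) x := by
  classical
  refine ⟨_, ⟨fun m => ∑ i ∈ Finset.range (k + 1),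
    if t * geomSum q' i = m then c i else 0, fun m => ?_, rfl⟩, fun x => ?_⟩
  · refine sum_mem fun i _ => ?_
    split_ifs
    exacts [hc i, zero_mem E]
  · rw [sigmaPoly_apply,
      Fin.sum_univ_eq_sum_range (fun m => (∑ i ∈ Finset.range (k + 1),
        if t * geomSum q' i = m then c i else 0) * (σ ^ m) x)]
    simp only [Finset.sum_mul, ite_mul, zero_mul]
    rw [Finset.sum_comm]
    refine Finset.sum_congr rfl fun i hi => ?_
    rw [Finset.sum_ite_eq, if_pos]
    have := (geomSum_strictMono hq').monotone (Nat.lt_succ_iff.1 (Finset.mem_range.1 hi))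
    exact Finset.mem_range.2 (Nat.lt_succ_of_le (Nat.mul_le_mul_left t this))

variable {n : ℕ}

theorem rk_le_finrank_range {L : Type*} [Field L] [Algebra F L] [FiniteDimensional F L]
    (T : L →ₗ[F] L) (G : L →ₗ[F] K) (y : Fin n → L) :
    rk F (fun i => G (T (y i))) ≤ Module.finrank F (LinearMap.range T) := by
  have : FiniteDimensional F ((LinearMap.range T).map G) := inferInstance
  refine (Submodule.finrank_mono ?_).trans (Submodule.finrank_map_le G (LinearMap.range T))
  rw [Submodule.span_le]
  rintro _ ⟨i, rfl⟩
  exact ⟨_, ⟨y i, rfl⟩, rfl⟩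

theorem IsBasisOfScaled.exists_coord {b : Fin n → K} {β : K} {L : IntermediateField F K}
    (hβ : β ≠ 0) (hb : IsBasisOfScaled b β L) :
    ∃ y : Fin n → L, (∀ i, b i = β * y i) ∧ Submodule.span F (Set.range y) = ⊤ := by
  have hmem : ∀ i, ∃ y : L, b i = β * y := fun i => by
    have : b i ∈ (Submodule.span F (Set.range b) : Set K) := Submodule.subset_span ⟨i, rfl⟩
    rw [hb.2] at this
    obtain ⟨y, hy, h⟩ := this
    exact ⟨⟨y, hy⟩, h⟩
  choose y hy using hmem
  refine ⟨y, hy, ?_⟩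
  let G : L →ₗ[F] K := LinearMap.mulLeft F β ∘ₗ L.val.toLinearMap
  have hG : Function.Injective G := fun u v h =>
    Subtype.ext (mul_left_cancel₀ hβ h)
  apply Submodule.map_injective_of_injective hG
  rw [Submodule.map_span, ← Set.range_comp]
  have : (G ∘ y) = b := funext fun i => (hy i).symm
  rw [this]
  apply SetLike.coe_injective
  rw [hb.2]
  ext x
  constructor
  · rintro ⟨u, hu, rfl⟩
    exact ⟨⟨u, hu⟩, trivial, rfl⟩
  · rintro ⟨u, -, rfl⟩
    exact ⟨u, u.2, rfl⟩

/-- The codewords near the word `σ ^ j (σ ^ (t * p_{k - 1}) (b i))`. -/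
theorem sub_mem_evalCode (σ : K ≃ₐ[F] K) (L E : IntermediateField F K) {q' t k j : ℕ}
    (hq' : 0 < q') (hk : 0 < k) (τ : L ≃ₐ[F] L)
    (hστ : ∀ x : L, ((τ x : L) : K) = σ x) (hE : ∀ x ∈ E, σ x ∈ E) (hLE : L ≤ E)
    {β : K} (hβ : β ≠ 0) (hβE : β ∈ E)
    {b : Fin n → K} {y : Fin n → L} (hy : ∀ i, b i = β * y i) {𝒞 : Set (K →ₗ[F] K)}
    (h𝒞 : sigmaTwist σ j (gabidulin σ E (t * geomSum q' (k - 1) + 1)) ⊆ 𝒞) (α : Lˣ) :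
    (fun i => (σ ^ j) ((σ ^ (t * geomSum q' k)) (b i)) -
      (σ ^ j) ((σ ^ (t * geomSum q' k)) β * (monicTwist τ q' t k α (y i) : L))) ∈
        evalCode b 𝒞 := by
  have hpow : ∀ (m : ℕ) (x : L), (((τ ^ m) x : L) : K) = (σ ^ m) (x : K) := by
    intro m
    induction m with
    | zero => intro x; simp
    | succ m ih => intro x; rw [pow_succ, pow_succ, AlgEquiv.mul_apply, AlgEquiv.mul_apply, ih, hστ]
  have hEpow : ∀ (m : ℕ), ∀ x ∈ E, (σ ^ m) x ∈ E := by
    intro m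
    induction m with
    | zero => intro x hx; simpa using hx
    | succ m ih => intro x hx; rw [pow_succ, AlgEquiv.mul_apply]; exact ih _ (hE x hx)
  set N := t * geomSum q' k with hN
  -- These are the negated non-leading coefficients of the monic twist, scaled by `σ^N β`. Dividing
  -- `α` by `β` compensates for evaluating at `b i = β * y i`.
  obtain ⟨f, hf, hfx⟩ := exists_mem_gabidulin_eq_sum σ E (k := k - 1) hq'
    (fun i => -((σ ^ N) β * ((σ ^ N) (α : L))⁻¹ * (σ ^ (t * geomSum q' i)) ((α : L) / β)))
    (fun i => neg_mem (mul_mem (mul_mem (hEpow _ _ hβE)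
      (inv_mem (hEpow _ _ (hLE (α : L).2)))) (hEpow _ _ (div_mem (hLE (α : L).2) hβE))))
  refine ⟨_, h𝒞 ⟨f, hf, rfl⟩, funext fun i => ?_⟩
  rw [← map_sub]
  change (σ ^ j) (f (b i)) = _
  congr 1
  rw [hfx, Nat.sub_add_cancel hk, monicTwist_apply, Finset.sum_range_succ]
  have hα : (σ ^ N) (α : L) ≠ 0 :=
    (map_ne_zero_iff _ (σ ^ N).injective).2 (by simp)
  have hα' : (τ ^ N) (α : L) ≠ 0 := (map_ne_zero_iff _ (τ ^ N).injective).2 α.ne_zero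
  rw [← hN, inv_mul_cancel₀ hα', one_mul]
  push_cast
  simp only [hpow, hy i, map_mul, map_div₀, mul_add, Finset.mul_sum]
  rw [sub_add_eq_sub_sub, sub_right_comm, sub_self, zero_sub, ← Finset.sum_neg_distrib]
  refine Finset.sum_congr rfl fun m _ => ?_
  have hb0 : (σ ^ (t * geomSum q' m)) β ≠ 0 := (map_ne_zero_iff _ (σ ^ _).injective).2 hβ
  field_simp

end Transport

end RankMetric

namespace RankMetric

open Polynomial Turing

/-! ### The word with many close codewords. -/

section Words

variable {F K : Type*} [Field F] [Field K] [Finite K] [Algebra F K]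

theorem exists_word_mul_ncard_le {p q r k t n s j : ℕ} {L : IntermediateField F K}
    {σ : K ≃ₐ[F] K} {β : K} {b : Fin n → K} {𝒞 : Set (K →ₗ[F] K)}
    (hp : p.Prime) (hq : ∃ e, 0 < e ∧ q = p ^ e) (hF : Nat.card F = q)
    (hk : 0 < k) (ht : 0 < t) (hn : n = t * geomSum (p ^ r) (k + 1))
    (hL : Module.finrank F L = n) (hsn : s.Coprime n) (hσ : ∀ x, σ x = x ^ q ^ s)
    (hβ : β ≠ 0) (hb : IsBasisOfScaled b β L)
    (hd : t * (p ^ r) ^ k ≤ minDist F (evalCode b 𝒞) - 1)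
    (h2 : sigmaTwist σ j (gabidulin σ ⊤ (t * geomSum (p ^ r) (k - 1) + 1)) ⊆ 𝒞 ∨
      (β ∈ L ∧ sigmaTwist σ j (gabidulin σ L (t * geomSum (p ^ r) (k - 1) + 1)) ⊆ 𝒞))
    {ρ : ℕ} (hρ : t * (p ^ r) ^ k ≤ ρ) :
    ∃ w : Fin n → K, w ∉ evalCode b 𝒞 ∧
      q ^ n - 1 ≤ (q ^ t - 1) * (evalCode b 𝒞 ∩ rankBall F ρ w).ncard := by
  have : Fact p.Prime := ⟨hp⟩
  have hq' : 0 < p ^ r := pow_pos hp.pos r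
  obtain ⟨e, he, rfl⟩ := hq
  have hq1 : 1 < p ^ e := Nat.one_lt_pow he.ne' hp.one_lt
  have : Finite F := Finite.of_injective _ (algebraMap F K).injective
  have := Fintype.ofFinite F
  have : CharP F p := charP_of_card_eq_prime_pow (f := e)
    (by rw [← Nat.card_eq_fintype_card, hF])
  have : FiniteDimensional F L := Module.Finite.of_finite
  obtain ⟨τ, hτs, hτn, hgen, hfix⟩ := exists_generator_pow_card hL hsn
  rw [hF] at hτs hfix
  have hστ : ∀ x : L, ((τ x : L) : K) = σ x := fun x => by rw [hτs, hσ]; rfl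
  obtain ⟨y, hy, hspan⟩ := hb.exists_coord hβ
  -- Both alternatives of the hypothesis become one: a coefficient field `E` containing `L` and `β`.
  obtain ⟨E, hLE, hβE, hE⟩ : ∃ E : IntermediateField F K, L ≤ E ∧ β ∈ E ∧
      sigmaTwist σ j (gabidulin σ E (t * geomSum (p ^ r) (k - 1) + 1)) ⊆ 𝒞 := by
    rcases h2 with h | ⟨hβL, h⟩
    exacts [⟨⊤, le_top, trivial, h⟩, ⟨L, le_rfl, hβL, h⟩]
  have hEσ : ∀ x ∈ E, σ x ∈ E := fun x hx => by rw [hσ]; exact pow_mem hx _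
  set w : Fin n → K := fun i => (σ ^ j) ((σ ^ (t * geomSum (p ^ r) k)) (b i)) with hw
  let G : L →ₗ[F] K := (σ ^ j).toLinearMap ∘ₗ
    LinearMap.mulLeft F ((σ ^ (t * geomSum (p ^ r) k)) β) ∘ₗ L.val.toLinearMap
  have hG : Function.Injective G := fun u v h => Subtype.ext <| mul_left_cancel₀
    ((map_ne_zero_iff _ (σ ^ (t * geomSum (p ^ r) k)).injective).2 hβ) ((σ ^ j).injective h)
  let cw : Lˣ → Fin n → K := fun α => w - fun i => G (monicTwist τ (p ^ r) t k α (y i))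
  have hcw : ∀ α, cw α ∈ evalCode b 𝒞 := fun α =>
    sub_mem_evalCode σ L E hq' hk τ hστ hEσ hLE hβ hβE hy hE α
  obtain ⟨Q, hQm, hQd, hQ⟩ := exists_cofactor_lacunaryTrace (F := F) (t := t) (k := k) p r ht
  have hrk : ∀ α, rk F (w - cw α) ≤ t * (p ^ r) ^ k := by
    intro α
    have h1 : w - cw α = fun i => G (monicTwist τ (p ^ r) t k α (y i)) := sub_sub_cancel _ _
    rw [h1, ← hQd]
    refine (rk_le_finrank_range _ _ _).trans ((finrank_range_monicTwist_le τ _ _ _ α).trans ?_)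
    exact finrank_range_aeval_le τ hgen (n := t * geomSum (p ^ r) (k + 1))
      (by rw [← hn, ← hτn, pow_orderOf_eq_one]) hQm hQ
  have hinj : ∀ α α', cw α = cw α' → (τ ^ t) ((α : L) / α') = α / α' := by
    intro α α' h
    refine fixed_of_monicTwist_eq τ hq' ht hk (by rw [← hn, hτn]) ?_
    refine LinearMap.ext_on hspan ?_
    rintro _ ⟨i, rfl⟩
    exact hG (congrFun (sub_right_injective h) i)
  have hcount := card_sub_one_le_mul_card_range hq1 ht (hfix t) cw hinj
  have hcardL : Nat.card L = (p ^ e) ^ n := by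
    rw [Module.natCard_eq_pow_finrank (K := F), hF, hL]
  rw [hcardL] at hcount
  refine ⟨w, fun hwC => ?_, hcount.trans (Nat.mul_le_mul_left _ ?_)⟩
  · have htn : t < n := by
      rw [hn]; exact lt_mul_of_one_lt_right ht (one_lt_geomSum_succ hq' hk)
    -- The minimum distance needs a codeword other than `w`. If every `cw α` were `w`, the count
    -- would give `q^n - 1 ≤ q^t - 1`, against `t < n`.
    obtain ⟨α, hα⟩ : ∃ α, w ≠ cw α := by
      by_contra! hall
      have hr : Set.range cw ⊆ {w} := by
        rintro _ ⟨α, rfl⟩; exact (hall α).symm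
      have h1 := Set.ncard_le_ncard hr
      rw [Set.ncard_singleton] at h1
      have h2 := hcount.trans (Nat.mul_le_mul_left _ h1)
      have h3 : (p ^ e) ^ t < (p ^ e) ^ n := Nat.pow_lt_pow_right hq1 htn
      have h4 : 0 < (p ^ e) ^ t := pow_pos (by omega) _
      omega
    have h1 : minDist F (evalCode b 𝒞) ≤ rk F (w - cw α) :=
      Nat.sInf_le ⟨w, hwC, cw α, hcw α, hα, rfl⟩
    have h2 := hrk α
    -- Subtraction in `d - 1` is truncated; positivity excludes `d = 0`.
    have h3 : 0 < t * (p ^ r) ^ k := Nat.mul_pos ht (pow_pos hq' k)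
    omega
  · refine Set.ncard_le_ncard ?_ (Set.toFinite _)
    rintro _ ⟨α, rfl⟩
    exact ⟨hcw α, (hrk α).trans hρ⟩

end Words

/-! ### Output length against running time. -/

section Machine

/-- Tape positions are relative to the head, so a move shifts the blank region by at most one. A
write affects only position `0`, which `0 < B` keeps outside that region. -/
theorem nth_eq_default_of_step {Γ Λ : Type*} [Inhabited Γ] [Inhabited Λ]
    {M : TM0.Machine Γ Λ} {c c' : TM0.Cfg Γ Λ} (h : TM0.step M c = some c') {B : ℤ} (hB : 0 < B)
    (hc : ∀ i : ℤ, B ≤ i → c.Tape.nth i = default) (i : ℤ) (hi : B + 1 ≤ i) :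
    c'.Tape.nth i = default := by
  obtain ⟨q, T⟩ := c
  simp only [TM0.step, Option.map_eq_some_iff] at h
  obtain ⟨⟨q', a⟩, -, rfl⟩ := h
  rcases a with (_ | _) | a
  · change (T.move Dir.left).nth i = _
    rw [Tape.move_left_nth]; exact hc _ (by omega)
  · change (T.move Dir.right).nth i = _
    rw [Tape.move_right_nth]; exact hc _ (by omega)
  · change (T.write a).nth i = _
    rw [Tape.write_nth, if_neg (by omega)]; exact hc _ (by omega)

theorem nth_eq_default_of_iterate {Γ Λ : Type*} [Inhabited Γ] [Inhabited Λ]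
    {M : TM0.Machine Γ Λ} {c : TM0.Cfg Γ Λ} {B : ℤ} (hB : 0 < B)
    (hc : ∀ i : ℤ, B ≤ i → c.Tape.nth i = default) (T : ℕ) {c' : TM0.Cfg Γ Λ}
    (h : (flip bind (TM0.step M))^[T] (some c) = some c') (i : ℤ) (hi : B + T ≤ i) :
    c'.Tape.nth i = default := by
  induction T generalizing c' i with
  | zero =>
    obtain rfl : c = c' := by simpa using h
    exact hc i (by simpa using hi)
  | succ T ih =>
    rw [Function.iterate_succ_apply'] at h
    obtain ⟨c₁, h₁, h₂⟩ := Option.bind_eq_some_iff.1 h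
    exact nth_eq_default_of_step h₂ (B := B + T) (by omega) (fun i hi => ih h₁ i hi) i
      (by push_cast at hi; omega)

/-- After at most `T` steps the cell at distance `inp.length + T` to the right of the head is blank,
while encoded output symbols never are. -/
theorem TapeMachine.OutputsInTime.length_le {K : Type*} {A : TapeMachine K} {inp out : List K}
    {T : ℕ} (h : A.OutputsInTime inp out T) (hinp : 0 < inp.length) :
    out.length ≤ inp.length + T := by
  obtain ⟨c, ⟨⟨⟨m, hm⟩, hmT⟩⟩, -, hout⟩ := h
  by_contra! hlt
  have hinit : ∀ i : ℤ, (inp.length : ℤ) ≤ i →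
      (TM0.init (Λ := A.State) (inp.map A.enc)).Tape.nth i = default := by
    intro i hi
    lift i to ℕ using by omega
    change (Tape.mk₁ _).nth _ = _
    rw [Tape.mk₁, Tape.mk₂, Tape.mk'_nth_nat, ListBlank.nth_mk]
    exact List.getI_eq_default _ (by simpa using hi)
  have h1 := nth_eq_default_of_iterate (by exact_mod_cast hinp) hinit m hm
    ((inp.length + T : ℕ) : ℤ) (by push_cast; simp at hmT; omega)
  rw [← Tape.right₀_nth, hout, ListBlank.nth_mk, List.getI_eq_getElem _ (by simpa using hlt),
    List.getElem_map] at h1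
  exact A.enc_ne_blank _ h1

theorem TapeMachine.ListDecodesInTime.ncard_le {F K : Type*} [Field F] [Field K] [Algebra F K]
    {n : ℕ} {A : TapeMachine K} {C : Set (Fin n → K)} {ρ T : ℕ}
    (h : A.ListDecodesInTime F C ρ T) (hn : 0 < n) (w : Fin n → K) :
    (C ∩ rankBall F ρ w).ncard ≤ n + T := by
  classical
  obtain ⟨l, hl, hA⟩ := h w
  have h1 := hA.length_le (by simpa using hn)
  have h2 : (l.flatMap (List.ofFn (n := n))).length = l.length * n := by
    simp [List.length_flatMap]
  have h3 : C ∩ rankBall F ρ w = (l.toFinset : Set (Fin n → K)) := by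
    ext c; simp only [← hl, Finset.mem_coe, List.mem_toFinset]
  rw [h2, List.length_ofFn] at h1
  rw [h3, Set.ncard_coe_finset]
  exact l.toFinset_card_le.trans ((Nat.le_mul_of_pos_right _ hn).trans h1)

end Machine

theorem eventually_eval_lt_two_pow (P : Polynomial ℕ) :
    ∀ᶠ n : ℕ in Filter.atTop, P.eval n < 2 ^ n := by
  have h : (fun n : ℕ => ((P.eval n : ℕ) : ℝ)) =o[Filter.atTop] fun n : ℕ => (2 : ℝ) ^ n := by
    simp only [Polynomial.eval_eq_sum_range, Nat.cast_sum, Nat.cast_mul, Nat.cast_pow]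
    exact Asymptotics.IsLittleO.fun_sum fun i _ =>
      (isLittleO_pow_const_const_pow_of_one_lt (R := ℝ) i one_lt_two).const_mul_left _
  filter_upwards [h.bound (c := 1 / 2) (by norm_num)] with n hn
  rw [Real.norm_of_nonneg (by positivity), Real.norm_of_nonneg (by positivity)] at hn
  have h2 : (0 : ℝ) < 2 ^ n := by positivity
  have h3 : ((P.eval n : ℕ) : ℝ) < 2 ^ n := by linarith
  exact_mod_cast h3

/-- The quotient `(q^n - 1)/(q^t - 1)` is at least `q^(n-t)`, and `n - t ≥ n/2`. Squaring avoids
halving `n`. -/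
theorem two_pow_le_sq {q t n N : ℕ} (hq : 1 < q) (ht : 0 < t) (htn : 2 * t ≤ n)
    (h : q ^ n - 1 ≤ (q ^ t - 1) * N) : 2 ^ n ≤ N ^ 2 := by
  have hqt : 1 < q ^ t := Nat.one_lt_pow ht.ne' hq
  have h1 : q ^ (n - t) ≤ N := by
    have hmul : q ^ n = q ^ t * q ^ (n - t) := by rw [← pow_add]; congr 1; omega
    have hpos : 0 < q ^ (n - t) := pow_pos (by omega) _
    obtain ⟨a, ha⟩ := Nat.exists_eq_add_of_lt hqt
    refine Nat.le_of_mul_le_mul_left (c := q ^ t - 1) (le_trans ?_ h) (by omega)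
    rw [hmul, Nat.sub_mul, one_mul]
    omega
  calc 2 ^ n ≤ 2 ^ ((n - t) * 2) := Nat.pow_le_pow_right two_pos (by omega)
    _ = (2 ^ (n - t)) ^ 2 := pow_mul _ _ _
    _ ≤ (q ^ (n - t)) ^ 2 := Nat.pow_le_pow_left (Nat.pow_le_pow_left hq _) 2
    _ ≤ N ^ 2 := Nat.pow_le_pow_left h1 2

end RankMetric

theorem mainTheorem6 {ι : Type*} (p q r k t n m s j d : ι → ℕ) (F K : ι → Type*)
    [∀ i, Field (F i)] [∀ i, Field (K i)] [∀ i, Finite (K i)] [∀ i, Algebra (F i) (K i)]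
    (L : ∀ i, IntermediateField (F i) (K i)) (σ : ∀ i, K i ≃ₐ[F i] K i)
    (β : ∀ i, K i) (b : ∀ i, Fin (n i) → K i) (𝒞 : ∀ i, Set (K i →ₗ[F i] K i))
    (hp : ∀ i, (p i).Prime) (hq : ∀ i, ∃ e, 0 < e ∧ q i = p i ^ e)
    (hF : ∀ i, Nat.card (F i) = q i)
    (hk : ∀ i, 0 < k i) (ht : ∀ i, 0 < t i)
    (hn : ∀ i, n i = t i * RankMetric.geomSum (p i ^ r i) (k i + 1))
    (hm : ∀ i, Module.finrank (F i) (K i) = m i) (hnm : ∀ i, n i ∣ m i)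
    (hL : ∀ i, Module.finrank (F i) (L i) = n i)
    (hs : ∀ i, 0 < s i) (hsn : ∀ i, (s i).Coprime (n i))
    (hσ : ∀ i x, σ i x = x ^ (q i) ^ (s i))
    (hβ : ∀ i, β i ≠ 0) (hb : ∀ i, RankMetric.IsBasisOfScaled (b i) (β i) (L i))
    (h𝒞 : ∀ i, 𝒞 i ⊆ RankMetric.sigmaPolys (σ i))
    (hd : ∀ i, RankMetric.minDist (F i) (RankMetric.evalCode (b i) (𝒞 i)) = d i)
    (h1 : ∀ i, (d i - 1) / 2 + 1 ≤ t i * (p i ^ r i) ^ k i ∧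
      t i * (p i ^ r i) ^ k i ≤ d i - 1)
    (hj : ∀ i, j i < t i * (p i ^ r i) ^ k i)
    (h2 : ∀ i,
      RankMetric.sigmaTwist (σ i) (j i) (RankMetric.gabidulin (σ i) ⊤
          (t i * RankMetric.geomSum (p i ^ r i) (k i - 1) + 1)) ⊆ 𝒞 i ∨
      (β i ∈ L i ∧
        RankMetric.sigmaTwist (σ i) (j i) (RankMetric.gabidulin (σ i) (L i)
          (t i * RankMetric.geomSum (p i ^ r i) (k i - 1) + 1)) ⊆ 𝒞 i)) :
    (∀ i, ∀ τ : ℕ, t i * (p i ^ r i) ^ k i ≤ τ →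
      ∃ w : Fin (n i) → K i, w ∉ RankMetric.evalCode (b i) (𝒞 i) ∧
        ((q i : ℝ) ^ n i - 1) / ((q i : ℝ) ^ t i - 1) ≤
          ((RankMetric.evalCode (b i) (𝒞 i) ∩ RankMetric.rankBall (F i) τ w).ncard : ℝ)) ∧
    (¬ BddAbove (Set.range n) →
      ∀ τ : ι → ℕ, (∀ i, t i * (p i ^ r i) ^ k i ≤ τ i) →
        ¬ RankMetric.EfficientlyListDecodable F
          (fun i => RankMetric.evalCode (b i) (𝒞 i)) τ) := by

  have hword := fun i (ρ : ℕ) (hρ : t i * (p i ^ r i) ^ k i ≤ ρ) =>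
    RankMetric.exists_word_mul_ncard_le (hp i) (hq i) (hF i) (hk i) (ht i) (hn i) (hL i) (hsn i)
      (hσ i) (hβ i) (hb i) ((h1 i).2.trans_eq (by rw [hd i])) (h2 i) hρ
  have hq1 : ∀ i, 1 < q i := fun i => by
    obtain ⟨e, he, h⟩ := hq i
    exact h ▸ Nat.one_lt_pow he.ne' (hp i).one_lt
  refine ⟨fun i ρ hρ => ?_, fun hunb ρ hρ => ?_⟩
  · obtain ⟨w, hw, hcard⟩ := hword i ρ hρ
    refine ⟨w, hw, ?_⟩
    have hqt : 1 < q i ^ t i := Nat.one_lt_pow (ht i).ne' (hq1 i)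
    have hqn : 1 ≤ q i ^ n i := Nat.one_le_pow _ _ (hq1 i).le
    have hqt' : (1 : ℝ) < (q i : ℝ) ^ t i := by exact_mod_cast hqt
    rw [div_le_iff₀ (sub_pos.2 hqt'), mul_comm]
    have h : ((q i ^ n i - 1 : ℕ) : ℝ) ≤ (((q i ^ t i - 1) *
      (RankMetric.evalCode (b i) (𝒞 i) ∩ RankMetric.rankBall (F i) ρ w).ncard : ℕ) : ℝ) :=
      Nat.cast_le.2 hcard
    rw [Nat.cast_mul, Nat.cast_sub hqn, Nat.cast_sub hqt.le] at h
    simpa using h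
  · rintro ⟨P, hP⟩
    -- The list size is at most `n + P(n)`, and its square must reach `2^n`; hence this polynomial.
    obtain ⟨N, hN⟩ := Filter.eventually_atTop.1
      (RankMetric.eventually_eval_lt_two_pow ((Polynomial.X + P) ^ 2))
    obtain ⟨_, ⟨i, rfl⟩, hi⟩ := not_bddAbove_iff.1 hunb N
    obtain ⟨A, hA⟩ := hP i
    obtain ⟨w, -, hcard⟩ := hword i (ρ i) (hρ i)
    have htn : 2 * t i ≤ n i := by
      rw [hn i, mul_comm]
      exact Nat.mul_le_mul_left _ (RankMetric.one_lt_geomSum_succ (pow_pos (hp i).pos _) (hk i))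
    have h3 := RankMetric.two_pow_le_sq (hq1 i) (ht i) htn hcard
    have h4 := Nat.pow_le_pow_left (hA.ncard_le (by have := ht i; omega) w) 2
    have h5 := hN (n i) hi.le
    rw [Polynomial.eval_pow, Polynomial.eval_add, Polynomial.eval_X] at h5
    exact absurd (h3.trans h4) (not_le.2 h5)
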